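/- Let $\langle X \mid R\rangle$ be a group presentation with $X$ a finite set and $R$ a subset of the free group $\mathcal F(X)$, let $\mathcal N$ be the normal closure of $R$ in $\mathcal F(X)$ (its elements are the relators), and let $|w|$ be the length of the reduced word representing $w\in\mathcal F(X)$. Every $w\in\mathcal N$ can be written in $\mathcal F(X)$ as a product $$w=a_1r_1a_1^{-1}\cdots a_kr_ka_k^{-1},\qquad a_i\in\mathcal F(X),\quad r_i\in R\cup R^{-1};$$ let $\mathrm{area}(w)$ be the least number $k$ of factors, and let $\mathrm{gwork}(w)$ be the least value of $|r_1|+\cdots+|r_k|$, over all such expressions of $w$. For $n\in\mathbb N$ put $$\Delta(n)=\max\{\mathrm{area}(w): w\in\mathcal N,\ |w|\le n\},\qquad \Omega_g(n)=\max\{\mathrm{gwork}(w): w\in\mathcal N,\ |w|\le n\};$$ $\Delta$ is the Dehn function and $\Omega_g$ the group work of the presentation. The presentation has solvable Word Problem if there is an algorithm deciding whether two given words on $X\cup X^{-1}$ represent the same element of $\mathcal F(X)/\mathcal N$. 1. If $R$ is decidable (there is an algorithm deciding whether the element of $\mathcal F(X)$ represented by a given word lies in $R$), then $\langle X\mid R\rangle$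 has solvable Word Problem if and only if $\Omega_g$ is computable, if and only if $\Omega_g$ is bounded above by a computable function $\mathbb N\to\mathbb N$. 2. If $R$ is finite, then $\langle X\mid R\rangle$ has solvable Word Problem if and only if $\Delta$ is computable, if and only if $\Delta$ is bounded above by a computable function $\mathbb N\to\mathbb N$. -/

import Mathlib

/-!
Group presentations `⟨X | R⟩` are given by a type `X` of generators and a set
`R : Set (FreeGroup X)` of defining relators. The presented group is `PresentedGroup R` and the
relators are the elements of `Subgroup.normalClosure R`. The length `|w|` of `w` in the free group,
seen as a reduced word, is `FreeGroup.norm w`. Words over the letters and their inverses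
are terms of `List (X × Bool)`; such a word `w` names the element `FreeGroup.mk w`.
Algorithms act on such words.
-/

namespace GroupPresentation

variable {X : Type*}

/-- `l = [(a₁, r₁), …, (aₖ, rₖ)]` expresses `w` as the product
`a₁ r₁ a₁⁻¹ ⋯ aₖ rₖ aₖ⁻¹` in the free group, where each `rᵢ` lies in the symmetrized set of defining
relators, that is `rᵢ ∈ R` or `rᵢ⁻¹ ∈ R`. If `R` contains the inverses of its elements,
this just says `rᵢ ∈ R`. -/
def IsExpression (R : Set (FreeGroup X)) (l : List (FreeGroup X × FreeGroup X))
    (w : FreeGroup X) : Prop :=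
  (∀ p ∈ l, p.2 ∈ R ∨ p.2⁻¹ ∈ R) ∧ (l.map fun p => p.1 * p.2 * p.1⁻¹).prod = w

/-- The area of a relator `w`: the least number of factors of an expression of `w`. -/
noncomputable def area (R : Set (FreeGroup X)) (w : FreeGroup X) : ℕ :=
  sInf {k | ∃ l, IsExpression R l w ∧ l.length = k}

/-- The group work of a relator `w`: the least value of `|r₁| + ⋯ + |rₖ|` over the expressions
of `w`. -/
noncomputable def gwork [DecidableEq X] (R : Set (FreeGroup X)) (w : FreeGroup X) : ℕ :=
  sInf {k | ∃ l, IsExpression R l w ∧ (l.map fun p => p.2.norm).sum = k}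

/-- The Dehn function: the largest area of a relator of length at most `n`
(for finite `X` there are finitely many such relators). -/
noncomputable def dehn [DecidableEq X] (R : Set (FreeGroup X)) (n : ℕ) : ℕ :=
  sSup {k | ∃ w ∈ Subgroup.normalClosure R, w.norm ≤ n ∧ area R w = k}

/-- The group work of the presentation: the largest group work of a relator of length at
most `n`. -/
noncomputable def groupWork [DecidableEq X] (R : Set (FreeGroup X)) (n : ℕ) : ℕ :=
  sSup {k | ∃ w ∈ Subgroup.normalClosure R, w.norm ≤ n ∧ gwork R w = k}

/-- The set of defining relators is decidable: an algorithm decides whether the element of the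
free group named by a given word is a defining relator. -/
def DecidablyRelated [Primcodable X] (R : Set (FreeGroup X)) : Prop :=
  ComputablePred fun w : List (X × Bool) => FreeGroup.mk w ∈ R

/-- Solvable Word Problem: an algorithm decides, given two words, whether they represent
the same element of the presented group. -/
def SolvableWordProblem [Primcodable X] (R : Set (FreeGroup X)) : Prop :=
  ComputablePred fun p : List (X × Bool) × List (X × Bool) =>
    PresentedGroup.mk R (FreeGroup.mk p.1) = PresentedGroup.mk R (FreeGroup.mk p.2)

/-- `g` is bounded above by a computable function. -/
def ComputablyBounded (g : ℕ → ℕ) : Prop :=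
  ∃ f : ℕ → ℕ, Computable f ∧ ∀ n, g n ≤ f n

/-- Every relator has an expression, so the minima in `area` and `gwork` are taken over nonempty
sets. -/
theorem exists_isExpression {R : Set (FreeGroup X)} {w : FreeGroup X}
    (hw : w ∈ Subgroup.normalClosure R) : ∃ l, IsExpression R l w := by
  induction hw using Subgroup.closure_induction with
  | mem x hx =>
    obtain ⟨r, hr, c, rfl⟩ := by
      simpa [Group.mem_conjugatesOfSet_iff, isConj_iff] using hx
    exact ⟨[(c, r)], by simp [hr], by simp⟩
  | one => exact ⟨[], by simp, by simp⟩
  | mul x y _ _ hx hy =>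
    obtain ⟨l, h1, rfl⟩ := hx
    obtain ⟨m, h2, rfl⟩ := hy
    refine ⟨l ++ m, fun p hp => ?_, by simp⟩
    rcases List.mem_append.1 hp with h | h
    exacts [h1 p h, h2 p h]
  | inv x _ hx =>
    obtain ⟨l, h1, rfl⟩ := hx
    refine ⟨(l.map fun p => (p.1, p.2⁻¹)).reverse, fun p hp => ?_, ?_⟩
    · obtain ⟨q, hq, rfl⟩ := List.mem_map.1 (List.mem_reverse.1 hp)
      simpa [or_comm] using h1 q hq
    · simp [List.prod_inv_reverse, List.map_reverse, Function.comp_def, mul_assoc]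

/-- Over finitely many generators there are finitely many elements of length at most `n`, so the
maxima in `dehn` and `groupWork` are taken over finite sets. -/
theorem finite_norm_le [Finite X] [DecidableEq X] (n : ℕ) :
    {w : FreeGroup X | w.norm ≤ n}.Finite :=
  Set.Finite.of_finite_image
    ((List.finite_length_le (X × Bool) n).subset (by rintro _ ⟨w, hw, rfl⟩; exact hw))
    FreeGroup.toWord_injective.injOn

end GroupPresentation

/-! A bound on the cost of a relator decides membership in the normal closure only if the
expressions to be searched form a finite set, so the conjugators `aᵢ` must be bounded too.
`IsExpression.exists_norm_le` bounds them by `|w| + Σ|rᵢ|`, at no extra cost.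

For this, costs are read as insertions. Inserting `rᵢ⁻¹` after each `rᵢ` in the unreduced word
`a₁r₁a₁⁻¹⋯aₖrₖaₖ⁻¹` makes it trivial. By `Fillable.of_red`, free reduction of the starting word
never increases the insertion cost, provided that cyclic permutations of relators may be inserted.
So the reduced word of `w` can be trivialized at the same cost, and undoing the insertions gives an
expression whose conjugators are prefixes of the words met on the way.

Hence "cost at most `m`" is decidable. A computable bound on the maximal cost then decides the Word
Problem; conversely, a solution of the Word Problem lets the maximal cost be computed from the
finitely many words of length at most `n`. -/

namespace GroupPresentation

/-! ### Inserting relators, and bounded conjugators -/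

open FreeGroup

variable {X : Type*}

/-- The words obtained by cyclically permuting the words in `S`. -/
def rotations (S : Set (List (X × Bool))) : Set (List (X × Bool)) :=
  {r | ∃ u v, r = v ++ u ∧ u ++ v ∈ S}

/-- `Insertion S w W c`: the word `W` arises from `w` by inserting successively cyclic permutations
of at most `c.1` words of `S`, of total length at most `c.2`. -/
inductive Insertion (S : Set (List (X × Bool))) (w : List (X × Bool)) :
    List (X × Bool) → ℕ × ℕ → Prop
  | refl (c : ℕ × ℕ) : Insertion S w w c
  | insert {a b r : List (X × Bool)} {c : ℕ × ℕ} : Insertion S w (a ++ b) c → r ∈ rotations S →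
      Insertion S w (a ++ r ++ b) (c + (1, r.length))

variable {S : Set (List (X × Bool))}

theorem rotations_comm {u v : List (X × Bool)} (h : u ++ v ∈ rotations S) :
    v ++ u ∈ rotations S := by
  obtain ⟨s, t, h, hs⟩ := h
  rcases List.append_eq_append_iff.1 h with ⟨a, rfl, rfl⟩ | ⟨a, rfl, rfl⟩
  · exact ⟨s ++ u, a, by simp, by simpa using hs⟩
  · exact ⟨a, v ++ t, by simp, by simpa using hs⟩

namespace Insertion

theorem length_le {w W : List (X × Bool)} {c : ℕ × ℕ} (h : Insertion S w W c) :
    W.length ≤ w.length + c.2 := by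
  induction h with
  | refl c => omega
  | insert _ _ ih => simp at ih ⊢; omega

theorem mono {w W : List (X × Bool)} {c d : ℕ × ℕ} (h : Insertion S w W c) (hcd : c ≤ d) :
    Insertion S w W d := by
  induction h generalizing d with
  | refl c => exact .refl d
  | @insert a b r c _ hr ih =>
    have h1 : c ≤ d - (1, r.length) := by
      simp only [Prod.le_def, Prod.fst_add, Prod.snd_add, Prod.fst_sub, Prod.snd_sub] at hcd ⊢
      omega
    have h2 : d = d - (1, r.length) + (1, r.length) := by
      simp only [Prod.le_def, Prod.fst_add, Prod.snd_add] at hcd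
      ext <;> simp <;> omega
    rw [h2]
    exact (ih h1).insert hr

theorem insert' {w W a b r : List (X × Bool)} {c d : ℕ × ℕ} (h : Insertion S w (a ++ b) c)
    (hr : r ∈ rotations S) (hW : W = a ++ r ++ b) (hd : d = c + (1, r.length)) :
    Insertion S w W d := by
  subst hW hd
  exact h.insert hr

theorem append_left (v : List (X × Bool)) {w W : List (X × Bool)} {c : ℕ × ℕ}
    (h : Insertion S w W c) : Insertion S (v ++ w) (v ++ W) c := by
  induction h with
  | refl c => exact .refl c
  | @insert a b r c _ hr ih => exact insert' (a := v ++ a) (by simpa using ih) hr (by simp) rfl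

theorem append_right (v : List (X × Bool)) {w W : List (X × Bool)} {c : ℕ × ℕ}
    (h : Insertion S w W c) : Insertion S (w ++ v) (W ++ v) c := by
  induction h with
  | refl c => exact .refl c
  | @insert a b r c _ hr ih => exact insert' (b := b ++ v) (by simpa using ih) hr (by simp) rfl

theorem trans {u v w : List (X × Bool)} {c d : ℕ × ℕ} (h : Insertion S u v c)
    (h' : Insertion S v w d) : Insertion S u w (c + d) := by
  induction h' with
  | refl d => exact h.mono le_self_add
  | insert _ hr ih => exact ih.insert' hr rfl (add_assoc _ _ _).symm

theorem append {u v U V : List (X × Bool)} {c d : ℕ × ℕ} (h : Insertion S u U c)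
    (h' : Insertion S v V d) : Insertion S (u ++ v) (U ++ V) (c + d) :=
  (h.append_right v).trans (h'.append_left U)

theorem insert_insertion {w A B T : List (X × Bool)} {c d : ℕ × ℕ} (h : Insertion S w (A ++ B) c)
    (hT : Insertion S [] T d) : Insertion S w (A ++ T ++ B) (c + d) :=
  h.trans (by simpa using (hT.append_left A).append_right B)

/-- A letter of the original word survives all insertions and separates those made on its left from
those made on its right, so the cost splits. -/
theorem exists_of_append_cons {u v W : List (X × Bool)} {x : X × Bool} {c : ℕ × ℕ}
    (h : Insertion S (u ++ x :: v) W c) :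
    ∃ U V c₁ c₂, W = U ++ x :: V ∧ c₁ + c₂ = c ∧ Insertion S u U c₁ ∧ Insertion S v V c₂ := by
  generalize hw : u ++ x :: v = w at h
  induction h with
  | refl c => exact ⟨u, v, c, 0, hw.symm, by simp, .refl _, .refl _⟩
  | @insert a b r c _ hr ih =>
    obtain ⟨U, V, c₁, c₂, h, rfl, hU, hV⟩ := ih
    rcases List.append_eq_append_iff.1 h with ⟨t, rfl, rfl⟩ | ⟨t, rfl, ht⟩
    · exact ⟨a ++ r ++ t, V, c₁ + (1, r.length), c₂, by simp, by abel, hU.insert hr, hV⟩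
    · rcases List.cons_eq_append_iff.1 ht with ⟨rfl, rfl⟩ | ⟨t, rfl, rfl⟩
      · exact ⟨U ++ r, V, c₁ + (1, r.length), c₂, by simp, by abel,
          insert' (b := []) (by simpa using hU) hr (by simp) rfl, hV⟩
      · exact ⟨U, t ++ r ++ b, c₁, c₂ + (1, r.length), by simp, by abel, hU, hV.insert hr⟩

theorem rotate {A B : List (X × Bool)} {c : ℕ × ℕ} (h : Insertion S [] (A ++ B) c) :
    Insertion S [] (B ++ A) c := by
  generalize hW : A ++ B = W at h
  induction h generalizing A B with
  | refl c =>
    obtain ⟨rfl, rfl⟩ := List.append_eq_nil_iff.1 hW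
    exact .refl c
  | @insert a b r c _ hr ih =>
    rw [List.append_assoc] at hW
    rcases List.append_eq_append_iff.1 hW with ⟨t, rfl, rfl⟩ | ⟨t, rfl, ht⟩
    · exact insert' (a := t) (b := b ++ A) (by simpa using ih (A := A) (B := t ++ b) (by simp)) hr
        (by simp) rfl
    · rcases List.append_eq_append_iff.1 ht with ⟨s, rfl, rfl⟩ | ⟨s, rfl, rfl⟩
      · exact insert' (a := B ++ a) (b := s) (by simpa using ih (A := a ++ s) (B := B) (by simp)) hr
          (by simp) rfl
      -- The cut falls inside the last inserted word: its rotation is inserted first, and the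
      -- rotated remainder goes into the middle of it.
      · have h0 : Insertion S [] (s ++ t) (0 + (1, (s ++ t).length)) :=
          insert' (a := []) (b := []) (.refl 0) (rotations_comm hr) (by simp) rfl
        simpa [add_comm] using h0.insert_insertion (ih rfl)

end Insertion

/-- The word `w` can be turned into a word representing `1` by an insertion of cost at
most `c`. -/
def Fillable (S : Set (List (X × Bool))) (w : List (X × Bool)) (c : ℕ × ℕ) : Prop :=
  ∃ W, Insertion S w W c ∧ (mk W : FreeGroup X) = 1

theorem exists_append_cons_of_red {L u v : List (X × Bool)} {y : X × Bool}
    (h : Red L (u ++ y :: v)) : ∃ L₁ L₂, L = L₁ ++ y :: L₂ ∧ Red L₁ u ∧ Red L₂ v := by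
  induction h using Relation.ReflTransGen.head_induction_on with
  | refl => exact ⟨u, v, rfl, .refl, .refl⟩
  | head hstep _ ih =>
    obtain ⟨L₁, L₂, h, h₁, h₂⟩ := ih
    generalize hW : L₁ ++ y :: L₂ = W at h
    subst h
    obtain @⟨P, Q, z, d⟩ := hstep
    rcases List.append_eq_append_iff.1 hW with ⟨t, rfl, ht⟩ | ⟨t, rfl, rfl⟩
    · rcases List.cons_eq_append_iff.1 ht with ⟨rfl, rfl⟩ | ⟨t, rfl, rfl⟩
      · exact ⟨L₁ ++ [(z, d), (z, !d)], L₂, by simp,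
          .head (by simpa using Red.Step.not (L₁ := L₁) (L₂ := [])) h₁, h₂⟩
      · exact ⟨L₁, t ++ (z, d) :: (z, !d) :: Q, by simp, h₁, .head Red.Step.not h₂⟩
    · exact ⟨P ++ (z, d) :: (z, !d) :: t, L₂, by simp, .head Red.Step.not h₁, h₂⟩

/-- If `reduce B` does not begin with the inverse letter, then `(x, b) :: reduce B` is reduced; `A`
reduces to its inverse, hence ends in that letter. -/
theorem exists_cancelling_letter {A B : List (X × Bool)} {x : X} {b : Bool}
    (h : (mk (A ++ (x, b) :: B) : FreeGroup X) = 1) :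
    (∃ A₁ A₂, A = A₁ ++ (x, !b) :: A₂ ∧ (mk A₂ : FreeGroup X) = 1) ∨
      ∃ B₁ B₂, B = B₁ ++ (x, !b) :: B₂ ∧ (mk B₁ : FreeGroup X) = 1 := by
  classical
  by_cases hB : ∃ D, reduce B = (x, !b) :: D
  · obtain ⟨D, hD⟩ := hB
    obtain ⟨B₁, B₂, rfl, h₁, -⟩ := exists_append_cons_of_red (u := []) (hD ▸ reduce.red (L := B))
    exact .inr ⟨B₁, B₂, rfl, Red.exact.2 ⟨[], h₁, .refl⟩⟩
  · have hxB : reduce ((x, b) :: B) = (x, b) :: reduce B := by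
      rw [reduce.cons]
      rcases hr : reduce B with _ | ⟨⟨y, d⟩, tl⟩
      · rfl
      · simp only [ite_eq_right_iff, and_imp]
        rintro rfl rfl
        exact absurd ⟨tl, by simpa using hr⟩ hB
    have hA : mk A = (mk ((x, b) :: B) : FreeGroup X)⁻¹ :=
      eq_inv_of_mul_eq_one_left (by rwa [mul_mk])
    have hA' : reduce A = invRev (reduce B) ++ (x, !b) :: [] := by
      rw [← toWord_mk, hA, toWord_inv, toWord_mk, hxB, invRev_cons]
      rfl
    obtain ⟨A₁, A₂, rfl, -, h₂⟩ := exists_append_cons_of_red (hA' ▸ reduce.red (L := A))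
    exact .inl ⟨A₁, A₂, rfl, Red.exact.2 ⟨[], h₂, .refl⟩⟩

theorem mk_append (A B : List (X × Bool)) : (mk (A ++ B) : FreeGroup X) = mk A * mk B :=
  mul_mk.symm

/-- With the letter named `g`, equalities of words become group identities, uniformly in the sign
`b`. -/
theorem exists_mk_cons (x : X) (b : Bool) : ∃ g : FreeGroup X,
    (∀ L, mk ((x, b) :: L) = g * mk L) ∧ ∀ L, mk ((x, !b) :: L) = g⁻¹ * mk L :=
  ⟨mk [(x, b)], fun _ => (mul_mk (L₁ := [(x, b)])).symm,
    fun _ => (mul_mk (L₁ := [(x, !b)])).symm⟩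

namespace Fillable

/-- The trivial word has the form `U x T x⁻¹ V`, with `T` inserted between the cancelling pair.
Without the pair, `T` is dropped, moved or rotated, according to which letter `x` cancels against:
one in `U`, in `T`, in `V`, or the displayed `x⁻¹`. -/
theorem of_step {w w' : List (X × Bool)} {c : ℕ × ℕ} (h : Fillable S w c)
    (hw : Red.Step w w') : Fillable S w' c := by
  obtain @⟨u, v, x, b⟩ := hw
  obtain ⟨W, hW, h1⟩ := h
  obtain ⟨U, W, c₁, c', rfl, rfl, hU, hW⟩ := hW.exists_of_append_cons
  obtain ⟨T, V, c₂, c₃, rfl, rfl, hT, hV⟩ := Insertion.exists_of_append_cons (u := []) hW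
  have hUV := hU.append hV
  have reorder : c₁ + c₃ + c₂ = c₁ + (c₂ + c₃) := by abel
  have hcases := exists_cancelling_letter h1
  obtain ⟨g, hg, hg'⟩ := exists_mk_cons x b
  simp only [mk_append, hg, hg'] at h1
  rcases hcases with ⟨U₁, U₂, rfl, hU₂⟩ | ⟨B₁, B₂, hB, hB₁⟩
  · refine ⟨U₁ ++ T ++ ((x, !b) :: U₂ ++ V),
      reorder ▸ Insertion.insert_insertion (by simpa using hUV) hT, ?_⟩
    simp only [mk_append, hg', hU₂] at h1 ⊢
    simpa [mul_assoc, -mul_mk, -inv_mk] using h1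
  · rcases List.append_eq_append_iff.1 hB with ⟨t, rfl, ht⟩ | ⟨t, rfl, ht⟩
    · rcases List.cons_eq_append_iff.1 ht with ⟨rfl, ht⟩ | ⟨t, rfl, rfl⟩
      · refine ⟨U ++ V, hUV.mono (reorder ▸ le_self_add), ?_⟩
        rw [List.append_nil] at hB₁
        simpa [mk_append, hB₁, -mul_mk, -inv_mk] using h1
      -- The partner lies in `V = t x⁻¹ B₂` and `T x⁻¹ t = 1`, so `t T x⁻¹ = 1` as well.
      · refine ⟨U ++ t ++ T ++ ((x, !b) :: B₂),
          reorder ▸ Insertion.insert_insertion (by simpa using hUV) hT, ?_⟩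
        rw [mk_append, hg', ← mul_assoc] at hB₁
        have ht := eq_inv_of_mul_eq_one_right hB₁
        simp only [mk_append, hg', ht] at h1 ⊢
        simpa [mul_assoc, -mul_mk, -inv_mk] using h1
    · rcases List.cons_eq_append_iff.1 ht with ⟨rfl, ht⟩ | ⟨t, rfl, rfl⟩
      · refine ⟨U ++ V, hUV.mono (reorder ▸ le_self_add), ?_⟩
        rw [List.append_nil] at h1
        simpa [mk_append, hB₁, -mul_mk, -inv_mk] using h1
      -- The partner lies in `T = B₁ x⁻¹ t` with `B₁ = 1`; the rotation `t B₁ x⁻¹` has the value `t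
      -- x⁻¹` that is needed.
      · have hT' : Insertion S [] (t ++ (B₁ ++ [(x, !b)])) c₂ :=
          Insertion.rotate (by simpa using hT)
        refine ⟨U ++ (t ++ (B₁ ++ [(x, !b)])) ++ V, reorder ▸ hUV.insert_insertion hT', ?_⟩
        simp only [mk_append, hg', hB₁, ← one_eq_mk] at h1 ⊢
        simpa [mul_assoc, -mul_mk, -inv_mk] using h1

theorem of_red {w w' : List (X × Bool)} {c : ℕ × ℕ} (h : Fillable S w c) (hw : Red w w') :
    Fillable S w' c := by
  induction hw with
  | refl => exact h
  | tail _ hs ih => exact ih.of_step hs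

end Fillable

theorem mem_rotations {r : List (X × Bool)} (h : r ∈ S) : r ∈ rotations S :=
  ⟨r, [], rfl, by simpa using h⟩

variable [DecidableEq X] {R : Set (FreeGroup X)}

/-- The reduced words representing the symmetrized set of defining relators. -/
def relatorWords (R : Set (FreeGroup X)) : Set (List (X × Bool)) :=
  {r | ∃ g, (g ∈ R ∨ g⁻¹ ∈ R) ∧ g.toWord = r}

theorem IsExpression.fillable {l : List (FreeGroup X × FreeGroup X)} {w : FreeGroup X}
    (h : IsExpression R l w) :
    Fillable (relatorWords R) w.toWord (l.length, (l.map fun p => p.2.norm).sum) := by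
  obtain ⟨hR, rfl⟩ := h
  suffices ∃ V : List (X × Bool), mk V = (l.map fun p => p.1 * p.2 * p.1⁻¹).prod ∧
      Fillable (relatorWords R) V (l.length, (l.map fun p => p.2.norm).sum) by
    obtain ⟨V, hV, hf⟩ := this
    rw [← hV]
    exact hf.of_red reduce.red
  induction l with
  | nil => exact ⟨[], by simp [one_eq_mk], [], .refl _, rfl⟩
  | cons p l ih =>
    obtain ⟨a, r⟩ := p
    simp only [List.mem_cons, forall_eq_or_imp] at hR
    obtain ⟨V, hV, W, hW, h1⟩ := ih hR.2
    have hr : r⁻¹.toWord ∈ rotations (relatorWords R) :=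
      mem_rotations ⟨r⁻¹, by simpa [or_comm] using hR.1, rfl⟩
    refine ⟨a.toWord ++ r.toWord ++ (a⁻¹.toWord ++ V), ?_,
      a.toWord ++ r.toWord ++ r⁻¹.toWord ++ (a⁻¹.toWord ++ W),
      .insert' (((hW.append_left _).append_left _)) hr rfl ?_, ?_⟩
    · simp only [mk_append, mk_toWord, hV, List.map_cons, List.prod_cons, mul_assoc]
    · ext
      · simp
      · rw [Prod.snd_add, ← FreeGroup.norm, norm_inv_eq]; simp [add_comm]
    · simp [mk_append, mk_toWord, h1, -mul_mk, -toWord_inv]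

theorem Insertion.exists_isExpression {w W : List (X × Bool)} {c : ℕ × ℕ}
    (h : Insertion (relatorWords R) w W c) :
    ∃ l, IsExpression R l (mk w * (mk W)⁻¹) ∧ l.length ≤ c.1 ∧
      (l.map fun p => p.2.norm).sum ≤ c.2 ∧ ∀ p ∈ l, p.1.norm ≤ w.length + c.2 := by
  induction h with
  | refl c => exact ⟨[], ⟨by simp, (mul_inv_cancel _).symm⟩, by simp, by simp, by simp⟩
  | @insert a b r c hab hr ih =>
    obtain ⟨l, ⟨hR, hprod⟩, hlen, hsum, hnorm⟩ := ih
    obtain ⟨u, v, rfl, g, hg, hguv⟩ := hr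
    have hgmk : g = mk u * mk v := by rw [← mk_append, ← hguv, mk_toWord]
    have hgnorm : g.norm = u.length + v.length := by rw [FreeGroup.norm, hguv, List.length_append]
    have habl := hab.length_le
    -- For the rotation `r = vu` of `g = uv`, removing `r` after the prefix `a` costs the factor `a
    -- r⁻¹ a⁻¹ = (av) g⁻¹ (av)⁻¹`.
    refine ⟨l ++ [(mk (a ++ v), g⁻¹)], ⟨?_, ?_⟩, ?_, ?_, ?_⟩
    · intro p hp
      rcases List.mem_append.1 hp with hp | hp
      · exact hR p hp
      · rw [List.mem_singleton.1 hp]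
        simpa [or_comm] using hg
    · rw [List.map_append, List.prod_append, hprod]
      simp [hgmk, mk_append, mul_assoc, -mul_mk, -inv_mk]
    · simpa using hlen
    · simp [norm_inv_eq, hgnorm]
      omega
    · intro p hp
      rcases List.mem_append.1 hp with hp | hp
      · have := hnorm p hp
        simp only [Prod.snd_add]
        omega
      · rw [List.mem_singleton.1 hp]
        refine norm_mk_le.trans ?_
        simp at habl ⊢
        omega

/-- Conjugators in an expression may be taken of bounded length without increasing the number of
factors or the total length of the relators. -/
theorem IsExpression.exists_norm_le {l : List (FreeGroup X × FreeGroup X)} {w : FreeGroup X}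
    (h : IsExpression R l w) :
    ∃ l', IsExpression R l' w ∧ l'.length ≤ l.length ∧
      (l'.map fun p => p.2.norm).sum ≤ (l.map fun p => p.2.norm).sum ∧
      ∀ p ∈ l', p.1.norm ≤ w.norm + (l.map fun p => p.2.norm).sum := by
  obtain ⟨W, hW, h1⟩ := h.fillable
  simpa [h1, mk_toWord, FreeGroup.norm] using hW.exists_isExpression

end GroupPresentation

/-! ### Decidable predicates and bounded quantifiers -/

namespace ComputablePred

variable {α β : Type*} [Primcodable α] [Primcodable β]

theorem comp {p : β → Prop} {f : α → β} (hp : ComputablePred p) (hf : Computable f) :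
    ComputablePred fun a => p (f a) := by
  classical
  exact (hp.decide.comp hf).computablePred

theorem and {p q : α → Prop} (hp : ComputablePred p) (hq : ComputablePred q) :
    ComputablePred fun a => p a ∧ q a := by
  classical
  exact ((Primrec.and.to_comp.comp hp.decide hq.decide).of_eq fun a => by simp).computablePred

theorem or {p q : α → Prop} (hp : ComputablePred p) (hq : ComputablePred q) :
    ComputablePred fun a => p a ∨ q a := by
  classical
  exact ((Primrec.or.to_comp.comp hp.decide hq.decide).of_eq fun a => by simp).computablePred

theorem forall_mem {P : α → β → Prop} {l : α → List β}
    (hP : ComputablePred fun p : α × β => P p.1 p.2) (hl : Computable l) :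
    ComputablePred fun a => ∀ b ∈ l a, P a b := by
  classical
  -- Search for the first index whose entry is missing or violates `P`; it exists, and the entry is
  -- missing exactly when all of `l a` satisfies `P`.
  let Q : α → ℕ → Prop := fun a n => ∀ b, (l a)[n]? = some b → ¬ P a b
  have hget : Computable fun p : α × ℕ => (l p.1)[p.2]? :=
    Computable.list_getElem?.comp (hl.comp .fst) .snd
  have hQ : ComputablePred fun p : α × ℕ => Q p.1 p.2 := by
    have h : Computable fun p : α × ℕ =>
        (Option.casesOn ((l p.1)[p.2]?) true fun b => !decide (P p.1 b) : Bool) :=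
      Computable.option_casesOn hget (.const true)
        (Primrec.not.to_comp.comp (hP.decide.comp
          (f := fun p : α × β => decide (P p.1 p.2))
          (g := fun p : (α × ℕ) × β => (p.1.1, p.2))
          (.pair (Computable.fst.comp .fst) .snd))).to₂
    refine (h.of_eq fun p => ?_).computablePred
    rw [Bool.eq_iff_iff, decide_eq_true_iff]
    cases h : (l p.1)[p.2]? <;> simp [Q, h]
  have hex : ∀ a, ∃ n, Q a n := fun a => ⟨(l a).length, by simp [Q]⟩
  have hnone : ComputablePred fun o : Option β => o = none := by
    refine ((Computable.option_casesOn (f := fun _ : Option β => true) (g := fun _ _ => false)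
      .id (.const true) (Computable.const false).to₂).of_eq fun o => ?_).computablePred
    cases o <;> simp
  refine (hnone.comp (hget.comp (.pair .id (Computable.find hQ hex)))).of_eq fun a => ?_
  constructor
  · intro h b hb
    obtain ⟨n, hn, rfl⟩ := List.mem_iff_getElem.1 hb
    have hlt : n < Nat.find (hex a) := hn.trans_le (List.getElem?_eq_none_iff.1 h)
    have := Nat.find_min (hex a) hlt
    simpa [Q, hn] using this
  · intro h
    refine Option.eq_none_iff_forall_ne_some.2 fun b hb => ?_
    exact Nat.find_spec (hex a) b hb (h b (List.mem_of_getElem? hb))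

theorem exists_mem {P : α → β → Prop} {l : α → List β}
    (hP : ComputablePred fun p : α × β => P p.1 p.2) (hl : Computable l) :
    ComputablePred fun a => ∃ b ∈ l a, P a b :=
  (forall_mem (P := fun a b => ¬ P a b) hP.not hl).not.of_eq fun a => by simp

theorem computable_of_le {f : α → ℕ} (h : ComputablePred fun p : α × ℕ => f p.1 ≤ p.2) :
    Computable f := by
  classical
  refine (Computable.find h fun a => ⟨f a, le_rfl⟩).of_eq fun a => ?_
  exact (Nat.find_eq_iff _).2 ⟨le_rfl, fun n hn => not_le.2 hn⟩

end ComputablePred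

/-! ### Enumerating words and computing free reductions -/

namespace List

variable {α : Type*}

/-- The lists of length at most `n` with entries in `L`. -/
def tuples (L : List α) (n : ℕ) : List (List α) :=
  n.rec [[]] fun _ l => [] :: L.flatMap fun a => l.map (a :: ·)

theorem mem_tuples {L : List α} {n : ℕ} {l : List α} :
    l ∈ L.tuples n ↔ l.length ≤ n ∧ ∀ a ∈ l, a ∈ L := by
  induction n generalizing l with
  | zero => cases l <;> simp [tuples]
  | succ n ih =>
    change l ∈ [] :: L.flatMap (fun a => (L.tuples n).map (a :: ·)) ↔ _
    cases l with
    | nil => simp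
    | cons a l => simp [ih]; tauto

theorem primrec_tuples [Primcodable α] : Primrec₂ (tuples (α := α)) := by
  refine Primrec.nat_rec' (f := fun p : List α × ℕ => p.2)
    (g := fun _ => ([[]] : List (List α)))
    (h := fun p q => [] :: p.1.flatMap fun a => q.2.map (a :: ·)) .snd (.const _) ?_
  refine Primrec.list_cons.comp (.const []) (Primrec.list_flatMap (Primrec.fst.comp .fst) ?_)
  exact Primrec.list_map (Primrec.snd.comp (Primrec.snd.comp .fst))
    (Primrec.list_cons.comp (Primrec.snd.comp .fst) .snd)

end List

namespace FreeGroup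

variable {X : Type*} [Primcodable X]

theorem primrec_reduce [DecidableEq X] : Primrec (reduce (α := X)) := by
  have h : Primrec fun w : List (X × Bool) => w.foldr (fun x l =>
      (List.casesOn l [x] fun y tl => if x.1 = y.1 ∧ x.2 = not y.2 then tl else x :: y :: tl :
        List (X × Bool))) [] := by
    refine Primrec.list_foldr .id (.const [])
      (h := fun (_ : List (X × Bool)) (p : (X × Bool) × List (X × Bool)) => List.casesOn p.2 [p.1] fun y tl =>
        (if p.1.1 = y.1 ∧ p.1.2 = not y.2 then tl else p.1 :: y :: tl : List (X × Bool))) ?_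
    refine Primrec.list_casesOn
      (f := fun q : List (X × Bool) × (X × Bool) × List (X × Bool) => q.2.2)
      (g := fun q => [q.2.1])
      (h := fun q z => if q.2.1.1 = z.1.1 ∧ q.2.1.2 = not z.1.2 then z.2 else q.2.1 :: z.1 :: z.2)
      (Primrec.snd.comp .snd)
      (Primrec.list_cons.comp (Primrec.fst.comp .snd) (.const [])) ?_
    refine Primrec.ite (.and (Primrec.eq.comp ?_ ?_) (Primrec.eq.comp ?_ ?_)) ?_ ?_
    · exact Primrec.fst.comp (Primrec.fst.comp (Primrec.snd.comp .fst))
    · exact Primrec.fst.comp (Primrec.fst.comp .snd)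
    · exact Primrec.snd.comp (Primrec.fst.comp (Primrec.snd.comp .fst))
    · exact Primrec.not.comp (Primrec.snd.comp (Primrec.fst.comp .snd))
    · exact Primrec.snd.comp .snd
    · exact Primrec.list_cons.comp (Primrec.fst.comp (Primrec.snd.comp .fst))
        (Primrec.list_cons.comp (Primrec.fst.comp .snd) (Primrec.snd.comp .snd))
  refine h.of_eq fun w => ?_
  induction w with
  | nil => rfl
  | cons x w ih => rw [List.foldr_cons, ih, reduce.cons]

theorem primrec_invRev : Primrec (invRev (α := X)) :=
  Primrec.list_reverse.comp (Primrec.list_map .id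
    (Primrec.pair (Primrec.fst.comp .snd) (Primrec.not.comp (Primrec.snd.comp .snd))))

theorem primrecRel_mk_eq [DecidableEq X] :
    PrimrecRel fun v w : List (X × Bool) => (mk v : FreeGroup X) = mk w :=
  (Primrec.eq.comp (primrec_reduce.comp .fst) (primrec_reduce.comp .snd)).of_eq fun _ =>
    ⟨reduce.exact, reduce.sound⟩

end FreeGroup

/-! ### Bounded cost as a finite search over words -/

namespace GroupPresentation

open FreeGroup

variable {X : Type*} {R : Set (FreeGroup X)}

/-- The word representing the product `a₁ r₁ a₁⁻¹ ⋯ aₖ rₖ aₖ⁻¹` of a list of pairs of words. -/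
def conjugatesWord (l : List (List (X × Bool) × List (X × Bool))) : List (X × Bool) :=
  l.flatMap fun p => p.1 ++ p.2 ++ invRev p.1

theorem mk_conjugatesWord (l : List (List (X × Bool) × List (X × Bool))) :
    (mk (conjugatesWord l) : FreeGroup X) =
      (l.map fun p => (mk p.1 * mk p.2 * (mk p.1)⁻¹ : FreeGroup X)).prod := by
  induction l with
  | nil => rfl
  | cons p l ih =>
    rw [List.map_cons, List.prod_cons, ← ih, inv_mk, mul_mk, mul_mk, mul_mk]
    rfl

theorem exists_isExpression_iff_words [DecidableEq X] {L : List (X × Bool)} (hL : ∀ x, x ∈ L)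
    (w : List (X × Bool)) (m k : ℕ) :
    (∃ l, IsExpression R l (mk w) ∧ l.length ≤ m ∧ (l.map fun p => p.2.norm).sum ≤ k) ↔
      ∃ l ∈ ((L.tuples (w.length + k)).flatMap fun a => (L.tuples k).map fun r => (a, r)).tuples m,
        (∀ p ∈ l, mk p.2 ∈ R ∨ mk (invRev p.2) ∈ R) ∧
          (mk (conjugatesWord l) : FreeGroup X) = mk w ∧ (l.flatMap Prod.snd).length ≤ k := by
  simp only [List.mem_tuples, List.length_flatMap, mk_conjugatesWord]
  constructor
  · rintro ⟨l, hl, hm, hk⟩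
    obtain ⟨l, ⟨hR, hprod⟩, hm', hk', ha⟩ := hl.exists_norm_le
    have hk' := hk'.trans hk
    refine ⟨l.map fun p => (p.1.toWord, p.2.toWord), ⟨by simpa using hm'.trans hm, ?_⟩, ?_, ?_, ?_⟩
    · simp only [List.mem_map, forall_exists_index, and_imp, List.mem_flatMap, List.mem_tuples]
      rintro _ p hp rfl
      refine ⟨_, ⟨(ha p hp).trans (add_le_add norm_mk_le hk), fun _ _ => hL _⟩, _,
        ⟨?_, fun _ _ => hL _⟩, rfl⟩
      exact (List.single_le_sum (by simp) _ (List.mem_map_of_mem hp)).trans hk'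
    · simp only [List.mem_map, forall_exists_index, and_imp]
      rintro _ p hp rfl
      simpa [← inv_mk, mk_toWord] using hR p hp
    · simpa [Function.comp_def, mk_toWord, -mul_mk, -inv_mk] using hprod
    · simpa [Function.comp_def, FreeGroup.norm] using hk'
  · rintro ⟨l, ⟨hm, -⟩, hR, hprod, hk⟩
    refine ⟨l.map fun p => (mk p.1, mk p.2), ⟨?_, ?_⟩, by simpa using hm, ?_⟩
    · simp only [List.mem_map, forall_exists_index, and_imp]
      rintro _ p hp rfl
      exact hR p hp
    · rw [← hprod, List.map_map]; rfl
    · rw [List.map_map]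
      exact (List.sum_le_sum fun p _ => norm_mk_le).trans hk

theorem length_filter_le_sum_norm [DecidableEq X] (l : List (FreeGroup X × FreeGroup X)) :
    (l.filter fun p => p.2 ≠ 1).length ≤ (l.map fun p => p.2.norm).sum := by
  induction l with
  | nil => simp
  | cons p l ih =>
    by_cases h : p.2 = 1
    · simpa [h] using ih
    · have := Nat.pos_of_ne_zero (mt norm_eq_zero.1 h)
      simp [h] at ih ⊢
      omega

theorem IsExpression.filter [DecidableEq X] {l : List (FreeGroup X × FreeGroup X)}
    {w : FreeGroup X} (h : IsExpression R l w) :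
    IsExpression R (l.filter fun p => p.2 ≠ 1) w := by
  refine ⟨fun p hp => h.1 p (List.mem_of_mem_filter hp), h.2 ▸ ?_⟩
  clear h
  induction l with
  | nil => rfl
  | cons p l ih => by_cases hp : p.2 = 1 <;> simp_all

theorem IsExpression.mem_normalClosure {l : List (FreeGroup X × FreeGroup X)} {w : FreeGroup X}
    (h : IsExpression R l w) : w ∈ Subgroup.normalClosure R := by
  obtain ⟨hR, rfl⟩ := h
  refine Subgroup.list_prod_mem _ fun x hx => ?_
  obtain ⟨p, hp, rfl⟩ := List.mem_map.1 hx
  refine Subgroup.normalClosure_normal.conj_mem _ ?_ _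
  rcases hR p hp with h | h
  · exact Subgroup.subset_normalClosure h
  · exact inv_mem_iff.1 (Subgroup.subset_normalClosure h)

theorem area_le_iff {w : FreeGroup X} (hw : w ∈ Subgroup.normalClosure R) {m : ℕ} :
    area R w ≤ m ↔ ∃ l, IsExpression R l w ∧ l.length ≤ m := by
  constructor
  · intro h
    obtain ⟨l, hl, hk⟩ := Nat.sInf_mem (s := {k | ∃ l, IsExpression R l w ∧ l.length = k})
      ((exists_isExpression hw).elim fun l hl => ⟨_, l, hl, rfl⟩)
    exact ⟨l, hl, hk.trans_le h⟩
  · rintro ⟨l, hl, hm⟩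
    have h : area R w ≤ l.length := Nat.sInf_le ⟨l, hl, rfl⟩
    exact h.trans hm

theorem gwork_le_iff [DecidableEq X] {w : FreeGroup X} (hw : w ∈ Subgroup.normalClosure R)
    {m : ℕ} : gwork R w ≤ m ↔ ∃ l, IsExpression R l w ∧ (l.map fun p => p.2.norm).sum ≤ m := by
  constructor
  · intro h
    obtain ⟨l, hl, hk⟩ := Nat.sInf_mem
      (s := {k | ∃ l, IsExpression R l w ∧ (l.map fun p => p.2.norm).sum = k})
      ((exists_isExpression hw).elim fun l hl => ⟨_, l, hl, rfl⟩)
    exact ⟨l, hl, hk.trans_le h⟩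
  · rintro ⟨l, hl, hm⟩
    have h : gwork R w ≤ (l.map fun p => p.2.norm).sum := Nat.sInf_le ⟨l, hl, rfl⟩
    exact h.trans hm

/-- Factors with `r = 1` are free in group work and can be discarded; each remaining one has length
at least `1`, so the total length also bounds the number of factors. -/
theorem exists_sum_norm_le_iff [DecidableEq X] {w : FreeGroup X} {k : ℕ} :
    (∃ l, IsExpression R l w ∧ (l.map fun p => p.2.norm).sum ≤ k) ↔
      ∃ l, IsExpression R l w ∧ l.length ≤ k ∧ (l.map fun p => p.2.norm).sum ≤ k := by
  refine ⟨fun ⟨l, hl, hk⟩ => ⟨_, hl.filter, (length_filter_le_sum_norm l).trans hk, ?_⟩,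
    fun ⟨l, hl, _, hk⟩ => ⟨l, hl, hk⟩⟩
  exact ((List.filter_sublist.map _).sum_le_sum (by simp)).trans hk

theorem exists_length_le_iff [DecidableEq X] {M : ℕ} (hM : ∀ r ∈ R, r.norm ≤ M)
    {w : FreeGroup X} {m : ℕ} :
    (∃ l, IsExpression R l w ∧ l.length ≤ m) ↔
      ∃ l, IsExpression R l w ∧ l.length ≤ m ∧ (l.map fun p => p.2.norm).sum ≤ m * M := by
  refine ⟨fun ⟨l, hl, hm⟩ => ⟨l, hl, hm, ?_⟩, fun ⟨l, hl, hm, _⟩ => ⟨l, hl, hm⟩⟩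
  refine (List.sum_le_card_nsmul _ M ?_).trans ?_
  · simp only [List.mem_map, forall_exists_index, and_imp]
    rintro _ p hp rfl
    rcases hl.1 p hp with h | h
    exacts [hM _ h, norm_inv_eq (x := p.2) ▸ hM _ h]
  · simpa using Nat.mul_le_mul_right M hm

theorem sSup_norm_le_le_iff [Finite X] [DecidableEq X] (c : FreeGroup X → ℕ) (n m : ℕ) :
    sSup {k | ∃ w ∈ Subgroup.normalClosure R, w.norm ≤ n ∧ c w = k} ≤ m ↔
      ∀ w ∈ Subgroup.normalClosure R, w.norm ≤ n → c w ≤ m := by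
  have hfin : {k | ∃ w ∈ Subgroup.normalClosure R, w.norm ≤ n ∧ c w = k}.Finite :=
    ((finite_norm_le n).image c).subset (by rintro _ ⟨w, -, hn, rfl⟩; exact ⟨w, hn, rfl⟩)
  -- The relator `1` makes the set nonempty, as the criterion for `sSup` requires.
  rw [csSup_le_iff hfin.bddAbove ⟨_, 1, one_mem _, by simp, rfl⟩]
  exact ⟨fun h w hw hn => h _ ⟨w, hw, hn, rfl⟩, by rintro h _ ⟨w, hw, hn, rfl⟩; exact h w hw hn⟩

/-! ### Decidability of bounded cost and the Word Problem -/

section Computability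

variable [Primcodable X]

theorem DecidablyRelated.computablePred_exists_isExpression [Finite X] [DecidableEq X]
    (hR : DecidablyRelated R) :
    ComputablePred fun t : List (X × Bool) × ℕ × ℕ => ∃ l, IsExpression R l (mk t.1) ∧
      l.length ≤ t.2.1 ∧ (l.map fun p => p.2.norm).sum ≤ t.2.2 := by
  obtain ⟨L, hL⟩ := Finite.exists_univ_list (X × Bool)
  refine ComputablePred.of_eq ?_ fun t =>
    (exists_isExpression_iff_words hL.2 t.1 t.2.1 t.2.2).symm
  have hmem : ComputablePred fun q : List (List (X × Bool) × List (X × Bool)) =>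
      ∀ p ∈ q, mk p.2 ∈ R ∨ mk (invRev p.2) ∈ R := by
    have hR' : ComputablePred fun w : List (X × Bool) => mk w ∈ R ∨ mk (invRev w) ∈ R :=
      hR.or (ComputablePred.comp (p := fun w : List (X × Bool) => mk w ∈ R) hR
        primrec_invRev.to_comp)
    exact ComputablePred.forall_mem (P := fun _ (p : List (X × Bool) × List (X × Bool)) =>
      mk p.2 ∈ R ∨ mk (invRev p.2) ∈ R)
      (hR'.comp (f := fun q : List (List (X × Bool) × List (X × Bool)) ×
        List (X × Bool) × List (X × Bool) => q.2.2) (Computable.snd.comp .snd)) .id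
  have hword : Primrec (conjugatesWord (X := X)) := by
    refine Primrec.list_flatMap .id ?_
    exact Primrec.list_append.comp
      (Primrec.list_append.comp (Primrec.fst.comp .snd) (Primrec.snd.comp .snd))
      (primrec_invRev.comp (Primrec.fst.comp .snd))
  have hlen : Primrec fun l : List (List (X × Bool) × List (X × Bool)) =>
      (l.flatMap Prod.snd).length :=
    Primrec.list_length.comp (Primrec.list_flatMap .id (Primrec.snd.comp .snd))
  have hcand : Primrec fun t : List (X × Bool) × ℕ × ℕ =>
      (L.tuples (t.1.length + t.2.2)).flatMap fun a => (L.tuples t.2.2).map fun r => (a, r) := by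
    refine Primrec.list_flatMap (List.primrec_tuples.comp (.const L)
      (Primrec.nat_add.comp (Primrec.list_length.comp .fst) (Primrec.snd.comp .snd))) ?_
    exact Primrec.list_map (List.primrec_tuples.comp (.const L)
      (Primrec.snd.comp (Primrec.snd.comp .fst))) (Primrec.pair (Primrec.snd.comp .fst) .snd)
  refine ComputablePred.exists_mem (P := fun (t : List (X × Bool) × ℕ × ℕ) l =>
    (∀ p ∈ l, mk p.2 ∈ R ∨ mk (invRev p.2) ∈ R) ∧
      (mk (conjugatesWord l) : FreeGroup X) = mk t.1 ∧ (l.flatMap Prod.snd).length ≤ t.2.2)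
    (.and (hmem.comp .snd) (.and ?_ ?_))
    (List.primrec_tuples.comp hcand (Primrec.fst.comp .snd)).to_comp
  · exact (primrecRel_mk_eq.comp (hword.comp .snd) (Primrec.fst.comp .fst)).computablePred
  · exact (Primrec.nat_le.comp (hlen.comp .snd)
      (Primrec.snd.comp (Primrec.snd.comp .fst))).computablePred

theorem decidablyRelated_of_finite [DecidableEq X] (hR : R.Finite) : DecidablyRelated R := by
  induction R, hR using Set.Finite.induction_on with
  | empty =>
    exact ((Computable.const false).of_eq fun _ => by simp).computablePred (p := fun _ => _)
  | @insert a s _ _ ih =>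
    refine (ComputablePred.or (primrecRel_mk_eq.comp .id (.const a.toWord)).computablePred
      ih).of_eq fun w => ?_
    simp [mk_toWord]

theorem solvableWordProblem_iff :
    SolvableWordProblem R ↔
      ComputablePred fun w : List (X × Bool) => mk w ∈ Subgroup.normalClosure R := by
  have key (g h : FreeGroup X) : PresentedGroup.mk R g = PresentedGroup.mk R h ↔
      g⁻¹ * h ∈ Subgroup.normalClosure R := QuotientGroup.eq
  constructor
  · intro h
    refine (h.comp (f := fun w => ([], w)) (.pair (.const []) .id)).of_eq fun w => ?_
    rw [key, ← one_eq_mk, inv_one, one_mul]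
  · intro h
    refine (h.comp (f := fun p => invRev p.1 ++ p.2) (Primrec.list_append.comp
      (primrec_invRev.comp .fst) .snd).to_comp).of_eq fun p => ?_
    rw [key, inv_mk, mul_mk]

/-- If the relation `C w m`, for "the relator `w` has cost at most `m`", is decidable and only
holds for relators, then the maximal cost `F n` of the relators of length at most `n` is computable
if and only if the word problem is solvable, if and only if `F` is computably bounded. -/
theorem solvableWordProblem_iff_of_computablePred [Finite X] [DecidableEq X] {C : FreeGroup X → ℕ → Prop} {F : ℕ → ℕ}
    (hC : ComputablePred fun p : List (X × Bool) × ℕ => C (mk p.1) p.2)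
    (hmem : ∀ w m, C w m → w ∈ Subgroup.normalClosure R)
    (hF : ∀ n m, F n ≤ m ↔ ∀ w ∈ Subgroup.normalClosure R, w.norm ≤ n → C w m) :
    (SolvableWordProblem R ↔ Computable F) ∧ (SolvableWordProblem R ↔ ComputablyBounded F) := by
  have h₁ : SolvableWordProblem R → Computable F := by
    intro h
    obtain ⟨L, hL⟩ := Finite.exists_univ_list (X × Bool)
    have h' := solvableWordProblem_iff.1 h
    -- `F n ≤ m` is tested on all words of length at most `n`, reduced or not: an unreduced word
    -- only names an element of smaller norm.
    refine ComputablePred.computable_of_le ((ComputablePred.forall_mem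
      (P := fun (p : ℕ × ℕ) w => ¬ (mk w ∈ Subgroup.normalClosure R ∧ ¬ C (mk w) p.2))
      (l := fun p => L.tuples p.1) (.not (.and (h'.comp .snd) (.not (hC.comp
        (f := fun q : (ℕ × ℕ) × List (X × Bool) => (q.2, q.1.2))
        (.pair .snd (Computable.snd.comp .fst))))))
      (List.primrec_tuples.comp (.const L) .fst).to_comp).of_eq fun p => ?_)
    simp only [hF, List.mem_tuples, not_and, not_not]
    constructor
    · intro H w hw hn
      rw [← mk_toWord (x := w)] at hw ⊢
      exact H _ ⟨hn, fun _ _ => hL.2 _⟩ hw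
    · exact fun H w hw hN => H _ hN (norm_mk_le.trans hw.1)
  have h₂ : ComputablyBounded F → SolvableWordProblem R := by
    rintro ⟨f, hf, hFf⟩
    -- A word `w` is a relator exactly when its cost is at most `f w.length`.
    refine solvableWordProblem_iff.2 ((hC.comp
      (f := fun w : List (X × Bool) => (w, f w.length)) (.pair .id (hf.comp .list_length))).of_eq fun w => ⟨hmem _ _, fun h => ?_⟩)
    exact (hF _ _).1 (hFf _) _ h norm_mk_le
  have h₃ : Computable F → ComputablyBounded F := fun h => ⟨F, h, fun _ => le_rfl⟩
  exact ⟨⟨h₁, h₂ ∘ h₃⟩, h₃ ∘ h₁, h₂⟩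

end Computability

end GroupPresentation

theorem proposition6p6 {X : Type*} [Finite X] [DecidableEq X] [Primcodable X]
    (R : Set (FreeGroup X)) :
    (GroupPresentation.DecidablyRelated R →
      (GroupPresentation.SolvableWordProblem R ↔ Computable (GroupPresentation.groupWork R)) ∧
      (GroupPresentation.SolvableWordProblem R ↔
        GroupPresentation.ComputablyBounded (GroupPresentation.groupWork R))) ∧
    (R.Finite →
      (GroupPresentation.SolvableWordProblem R ↔ Computable (GroupPresentation.dehn R)) ∧
      (GroupPresentation.SolvableWordProblem R ↔
        GroupPresentation.ComputablyBounded (GroupPresentation.dehn R))) := by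
  open GroupPresentation in
  constructor
  · intro hR
    refine solvableWordProblem_iff_of_computablePred
      (C := fun w k => ∃ l, IsExpression R l w ∧ (l.map fun p => p.2.norm).sum ≤ k) ?_
      (fun w m ⟨l, hl, _⟩ => hl.mem_normalClosure) fun n m => ?_
    · refine (hR.computablePred_exists_isExpression.comp 
        (f := fun p : List (X × Bool) × ℕ => (p.1, p.2, p.2))
        (.pair .fst (.pair .snd .snd))).of_eq fun p => exists_sum_norm_le_iff.symm
    · rw [groupWork, sSup_norm_le_le_iff]
      exact forall₂_congr fun w hw => by rw [gwork_le_iff hw]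
  · intro hR
    obtain ⟨M, hM⟩ := (hR.image FreeGroup.norm).bddAbove
    have hM (r) (hr : r ∈ R) : r.norm ≤ M := hM ⟨r, hr, rfl⟩
    refine solvableWordProblem_iff_of_computablePred
      (C := fun w m => ∃ l, IsExpression R l w ∧ l.length ≤ m) ?_
      (fun w m ⟨l, hl, _⟩ => hl.mem_normalClosure) fun n m => ?_
    -- At most `m` factors, each of length at most `M`, have total length at most `m * M`.
    · refine ((decidablyRelated_of_finite hR).computablePred_exists_isExpression.comp
        (f := fun p : List (X × Bool) × ℕ => (p.1, p.2, p.2 * M)) (.pair .fst (.pair .snd (Primrec.nat_mul.comp .snd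
          (.const M)).to_comp))).of_eq fun p => (exists_length_le_iff hM).symm
    · rw [dehn, sSup_norm_le_le_iff]
      exact forall₂_congr fun w hw => by rw [area_le_iff hw]
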